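/- Let $H_1\neq H_2$ be two-dimensional linear subspaces of $\mathbb{R}^3$, let $\mathbf v_1,\dots,\mathbf v_n\in H_1$ span $H_1$, let $\mathbf w_1,\dots,\mathbf w_m\in H_2$, and suppose that the additive group generated by $\mathbf v_1,\dots,\mathbf v_n,\mathbf w_1,\dots,\mathbf w_m$ is discrete. Let $P=[\mathbf v_1]+\cdots+[\mathbf v_n]+[\mathbf w_1]+\cdots+[\mathbf w_m]$ be the corresponding two-flat zonotope (Minkowski sum), where $[\mathbf e]$ is the segment from $0$ to $\mathbf e$, and suppose that $P$ has non-empty interior. Then there are a positive integer $k$ and a set $\Lambda\subseteq\mathbb{R}^3$, having only finitely many points in each ball, such that $P$ tiles $\mathbb{R}^3$ at level $k$ by translations in $\Lambda$, that is, $\sum_{\lambda\in\Lambda}\mathbf 1_{P+\lambda}(x)=k$ for almost every $x\in\mathbb{R}^3$, and such that $\delta_\Lambda=\sum_{\lambda\in\Lambda}\delta_\lambda$ is not a finite linear combination of translated, possibly lower-dimensional, lattices: there are no $N\ge 0$, $q_1,\dots,q_N\in\mathbb{C}$ and translates $A_1,\dots,A_N$ of discrete additive subgroups of $\mathbb{R}^3$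 (of any rank $0,1,2,3$) with $\delta_\Lambda=\sum_{i=1}^N q_i\,\delta_{A_i}$ as distributions, where $\delta_{A}=\sum_{a\in A}\delta_a$. -/

import Mathlib

open MeasureTheory
open scoped Pointwise ENNReal ContDiff

noncomputable section

namespace MultipleTiling

/-- The zonotope which is the Minkowski sum of the segments `[u i]`,
each running from `0` to `u i`. -/
def zonotope {ι : Type*} [Fintype ι] (u : ι → EuclideanSpace ℝ (Fin 3)) :
    Set (EuclideanSpace ℝ (Fin 3)) :=
  ∑ i, segment ℝ 0 (u i)

/-- `Λ` is a discrete set of translation vectors: every ball contains only finitely many of its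
points. -/
def IsLocallyFinite (Λ : Set (EuclideanSpace ℝ (Fin 3))) : Prop :=
  ∀ R : ℝ, (Λ ∩ Metric.closedBall 0 R).Finite

/-- The translates of `P` by the elements of `Λ` form a tiling at level `k`: the sum over
`l ∈ Λ` of the indicator functions of `P + l` equals `k` almost everywhere. -/
def IsKTiling (P Λ : Set (EuclideanSpace ℝ (Fin 3))) (k : ℕ) : Prop :=
  ∀ᵐ x : EuclideanSpace ℝ (Fin 3),
    ∑' l : Λ, ((l : EuclideanSpace ℝ (Fin 3)) +ᵥ P).indicator (fun _ => (1 : ℝ≥0∞)) x = k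

/-- The measure `δ_Λ`, the sum over `l ∈ Λ` of the Dirac measures at `l`. -/
def delta (Λ : Set (EuclideanSpace ℝ (Fin 3))) : Measure (EuclideanSpace ℝ (Fin 3)) :=
  Measure.sum fun l : Λ => Measure.dirac (l : EuclideanSpace ℝ (Fin 3))

/-- `A` is a translated lattice, possibly of lower dimension: a translate of a discrete additive
subgroup of `ℝ³` of any rank `0`, `1`, `2` or `3`. -/
def IsTranslatedLattice (A : Set (EuclideanSpace ℝ (Fin 3))) : Prop :=
  ∃ (t : EuclideanSpace ℝ (Fin 3)) (L : AddSubgroup (EuclideanSpace ℝ (Fin 3))),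
    DiscreteTopology L ∧ A = t +ᵥ (L : Set (EuclideanSpace ℝ (Fin 3)))

/-- `μ` is a finite linear combination of the measures `δ_A` with `A` a translated, possibly
lower-dimensional, lattice. As coefficients may be negative or complex and the measures infinite,
the equality `μ = q₁ δ_{A₁} + ⋯ + q_N δ_{A_N}` is one of distributions. -/
def IsLatticeCombination (μ : Measure (EuclideanSpace ℝ (Fin 3))) : Prop :=
  ∃ (N : ℕ) (q : Fin N → ℂ) (A : Fin N → Set (EuclideanSpace ℝ (Fin 3))),
    (∀ i, IsTranslatedLattice (A i)) ∧
      ∀ φ : EuclideanSpace ℝ (Fin 3) → ℂ, ContDiff ℝ ∞ φ → HasCompactSupport φ →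
        ∫ x, φ x ∂μ = ∑ i, q i * ∫ x, φ x ∂(delta (A i))

end MultipleTiling

end

/-!
Let `G` be the discrete group generated by all the `v i` and `w j`. The translates of `P` by `G`
cover almost every point equally often (`exists_ae_cosetCount_eq`). The tiling is obtained by
combining shifted copies of `G`, with a different choice of shifts on either side of `H₁`.

Enlarging a convex set `S` by a segment `[u]` adds, on each line of direction `u` meeting `S`, a
half-open interval of length `u`. Summed over the translates by `ℤ u`, the gain is therefore the
indicator function of `S + ℝ u` (`cosetCount_add_segment`). Hence, when `W` is invariant under
translation by all `v i`, the multiplicity function `∑ g ∈ W, 1_{P + g}` is the sum of functions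
`fᵢ`, with `fᵢ` constant in the direction `v i`, and of the multiplicity function of
`[w 1] + ⋯ + [w m]`; the latter vanishes almost everywhere, as that set lies in the plane `H₂`.

For generic real `tᵢ` the measure obtained by convolving all the `δ_0 - δ_{tᵢ vᵢ}` with `v i ≠ 0`
is `δ_E - δ_O` with finite sets `E ∋ 0` and `O` whose points are distinct modulo `G`
(`exists_finset_sum_comp_sub_eq`), and its convolution with each `fᵢ` is zero. So shifting a
`v`-invariant part `W` of `G` by `E` or by `O` covers almost every point equally often
(`ae_sum_cosetCount_eq`).

With a linear functional `f` whose kernel is `H₁`, let `Λ` consist of the shifts by `E` of the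
points of `G` with `f ≥ 0` and the shifts by `O` of those with `f < 0`. The multiplicity of `Λ` is
almost everywhere that of `G + O`, which is `|O|` times that of `G`. If `u ∈ G` and `f u > 0`, then
`Λ` meets `ℤ u` in the half-line `ℕ u`. In a finite combination of translated lattices the masses at the points of
`ℤ u` form a function that is periodic up to finitely many points, which the indicator function of
a half-line is not (`not_isLatticeCombination_delta`).
-/

namespace MultipleTiling

/-! ### Enlarging a convex set by a segment -/

variable {X : Type*} [NormedAddCommGroup X] [NormedSpace ℝ X]

lemma mem_add_segment_zero {S : Set X} {y u : X} :
    y ∈ S + segment ℝ 0 u ↔ ∃ θ : ℝ, 0 ≤ θ ∧ θ ≤ 1 ∧ y - θ • u ∈ S := by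
  constructor
  · rintro ⟨s, hs, _, hz, rfl⟩
    rw [segment_eq_image'] at hz
    obtain ⟨θ, ⟨h0, h1⟩, rfl⟩ := hz
    exact ⟨θ, h0, h1, by simpa using hs⟩
  · rintro ⟨θ, h0, h1, hs⟩
    refine ⟨_, hs, θ • u, ?_, by simp⟩
    rw [segment_eq_image']
    exact ⟨θ, ⟨h0, h1⟩, by simp⟩

/-- On every line of direction `u` that meets the closed convex set `S` in a bounded set, the
points gained by adding the segment `[u]` to `S` form a half-open interval of length one (with
`u` as unit), so they contain exactly one point of every coset of `ℤ u`. -/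
lemma exists_forall_mem_add_segment_diff_iff {S : Set X} (hconv : Convex ℝ S) (hcl : IsClosed S)
    {y u : X} (hne : ∃ t : ℝ, y + t • u ∈ S)
    (hbd : Bornology.IsBounded {t : ℝ | y + t • u ∈ S}) :
    ∃ b : ℝ, ∀ t : ℝ,
      (y + t • u ∈ S + segment ℝ 0 u ∧ y + t • u ∉ S) ↔ b < t ∧ t ≤ b + 1 := by
  set I := {t : ℝ | y + t • u ∈ S} with hI
  have hIcl : IsClosed I := hcl.preimage (by fun_prop : Continuous fun t : ℝ => y + t • u)
  have hIc : IsCompact I := Metric.isCompact_of_isClosed_isBounded hIcl hbd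
  have hb : sSup I ∈ I := hIc.sSup_mem hne
  have hle : ∀ t ∈ I, t ≤ sSup I := fun t ht => le_csSup hIc.bddAbove ht
  have hIconv : Convex ℝ I := by
    intro s hs t ht a b ha hb hab
    have := hconv hs ht ha hb hab
    simp only [hI, Set.mem_ofPred_eq, smul_eq_mul]
    convert this using 1
    have : a • y + b • y = y := by rw [← add_smul, hab, one_smul]
    rw [smul_add, smul_add, add_smul, smul_smul, smul_smul]
    nth_rw 1 [← this]
    abel
  refine ⟨sSup I, fun t => ?_⟩
  have key : ∀ θ : ℝ, y + t • u - θ • u ∈ S ↔ t - θ ∈ I := fun θ => by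
    simp only [hI, Set.mem_ofPred_eq, sub_smul, add_sub_assoc]
  simp only [mem_add_segment_zero, key]
  constructor
  · rintro ⟨⟨θ, h0, h1, hθ⟩, hn⟩
    have := hle _ hθ
    refine ⟨?_, by linarith⟩
    by_contra! hlt
    exact hn (hIconv.ordConnected.out hθ hb ⟨by linarith, hlt⟩)
  · rintro ⟨h1, h2⟩
    exact ⟨⟨t - sSup I, by linarith, by linarith, by simpa using hb⟩,
      fun h => absurd (hle t h) (by linarith)⟩

/-- The number of cosets of `M` that contain a point `g` of `W` with `x ∈ S + g`. For `M`-invariant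
`S` and `W` this is the multiplicity at `x` of the family of translates of `S` by `W`, where
translates that differ by an element of `M` are counted once. -/
noncomputable def cosetCount {G : Type*} [AddCommGroup G] (M : AddSubgroup G) (W S : Set G)
    (x : G) : ℕ∞ :=
  ((QuotientAddGroup.mk : G → G ⧸ M) '' {g | g ∈ W ∧ x - g ∈ S}).encard

lemma cosetCount_bot {G : Type*} [AddCommGroup G] (W S : Set G) (x : G) :
    cosetCount ⊥ W S x = {g | g ∈ W ∧ x - g ∈ S}.encard := by
  refine Function.Injective.encard_image (fun a b hab => ?_) _
  have := QuotientAddGroup.eq.1 hab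
  rwa [AddSubgroup.mem_bot, neg_add_eq_zero] at this

lemma isBounded_setOf_add_smul_mem {V : Submodule ℝ X} [FiniteDimensional ℝ X] {K : Set X}
    (hK : IsCompact K) {u : X} (hu : u ∉ V) (y : X) :
    Bornology.IsBounded {t : ℝ | y + t • u ∈ (V : Set X) + K} := by
  obtain ⟨f, hfu, hfV⟩ := V.exists_dual_map_eq_bot_of_notMem hu inferInstance
  have hfc : Continuous f := f.continuous_of_finiteDimensional
  have hb := (hK.image (f := fun z => (f z - f y) * (f u)⁻¹) (by fun_prop)).isBounded
  refine hb.subset ?_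
  rintro t ⟨a, ha, z, hz, haz⟩
  refine ⟨z, hz, ?_⟩
  have h0 : f a = 0 := by
    have : f a ∈ V.map f := ⟨a, ha, rfl⟩
    rwa [hfV, Submodule.mem_bot] at this
  have := congrArg f haz
  simp only [map_add, map_smul, smul_eq_mul, h0, zero_add] at this
  field_simp
  linarith

/-- Adding the segment `[u]` to `V + K` raises the coset count by the coset count of the larger
set `V + ℝ u + K`, taken modulo the larger group `M + ℤ u`: by
`exists_forall_mem_add_segment_diff_iff`, each line of direction `u` which meets a translate of
`V + K` is gained by exactly one of the translates in its class modulo `ℤ u`. -/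
lemma cosetCount_add_segment [FiniteDimensional ℝ X] {M : AddSubgroup X} {V : Submodule ℝ X}
    (hMV : ∀ g ∈ M, g ∈ V) {K : Set X} (hK : IsCompact K) (hKc : Convex ℝ K) {u : X} (hu : u ∉ V)
    {W : Set X} (hW : ∀ g ∈ W, ∀ k : ℤ, g + k • u ∈ W) (x : X) :
    cosetCount M W (V + (K + segment ℝ 0 u)) x =
      cosetCount M W (V + K) x +
        cosetCount (M ⊔ AddSubgroup.zmultiples u) W
          ((V ⊔ Submodule.span ℝ {u} : Submodule ℝ X) + K) x := by
  set S : Set X := V + K with hS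
  have hScl : IsClosed S := V.closed_of_finiteDimensional.add_right_of_isCompact hK
  have hSc : Convex ℝ S := V.convex.add hKc
  have hSV : ∀ y ∈ S, ∀ a ∈ V, y + a ∈ S := by
    rintro _ ⟨b, hb, z, hz, rfl⟩ a ha
    exact ⟨b + a, V.add_mem hb ha, z, hz, by simp only; abel⟩
  have hSV' : ∀ y ∈ S + segment ℝ 0 u, ∀ a ∈ V, y + a ∈ S + segment ℝ 0 u := by
    rintro _ ⟨b, hb, z, hz, rfl⟩ a ha
    exact ⟨b + a, hSV b hb a ha, z, hz, by simp only; abel⟩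
  rw [← add_assoc, ← hS]
  set D : Set X := {g | g ∈ W ∧ x - g ∈ S + segment ℝ 0 u ∧ x - g ∉ S} with hD
  set C : Set X :=
    {g | g ∈ W ∧ x - g ∈ ((V ⊔ Submodule.span ℝ {u} : Submodule ℝ X) : Set X) + K} with hC
  have hsub : S ⊆ S + segment ℝ 0 u := fun y hy =>
    mem_add_segment_zero.2 ⟨0, le_rfl, zero_le_one, by simpa using hy⟩
  have hsplit : {g | g ∈ W ∧ x - g ∈ S + segment ℝ 0 u} = {g | g ∈ W ∧ x - g ∈ S} ∪ D := by
    ext g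
    simp only [hD, Set.mem_ofPred_eq, Set.mem_union]
    by_cases h : x - g ∈ S
    · simp [h, hsub h]
    · simp [h]
  have hdisj : Disjoint ((QuotientAddGroup.mk : X → X ⧸ M) '' {g | g ∈ W ∧ x - g ∈ S})
      ((QuotientAddGroup.mk : X → X ⧸ M) '' D) := by
    rw [Set.disjoint_left]
    rintro _ ⟨a, ⟨-, ha⟩, rfl⟩ ⟨d, ⟨-, -, hd⟩, hda⟩
    have := hMV _ (QuotientAddGroup.eq.1 hda)
    refine hd ?_
    convert hSV _ ha _ this using 1
    abel
  have hDC : (QuotientAddGroup.mk : X → X ⧸ M ⊔ AddSubgroup.zmultiples u) '' C =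
      (QuotientAddGroup.mk : X → X ⧸ M ⊔ AddSubgroup.zmultiples u) '' D := by
    apply subset_antisymm
    · rintro _ ⟨c, ⟨hcW, hc⟩, rfl⟩
      obtain ⟨p, hp, z, hz, haz⟩ := hc
      obtain ⟨a, ha, r, hr, rfl⟩ := Submodule.mem_sup.1 hp
      obtain ⟨t, rfl⟩ := Submodule.mem_span_singleton.1 hr
      obtain ⟨b, hb⟩ := exists_forall_mem_add_segment_diff_iff hSc hScl (y := x - c) (u := u)
        ⟨-t, a, ha, z, hz, by rw [← haz, neg_smul]; simp only; abel⟩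
        (isBounded_setOf_add_smul_mem hK hu _)
      -- `⌊b⌋ + 1` is the integer in the half-open interval from `b` to `b + 1`.
      have hk := (hb ((⌊b⌋ + 1 : ℤ) : ℝ)).2
        ⟨by push_cast; exact Int.lt_floor_add_one b, by push_cast; gcongr; exact Int.floor_le b⟩
      rw [Int.cast_smul_eq_zsmul] at hk
      have he : x - (c + (-(⌊b⌋ + 1)) • u) = x - c + (⌊b⌋ + 1) • u := by
        rw [neg_smul]; abel
      refine ⟨c + (-(⌊b⌋ + 1)) • u, ⟨hW c hcW _, ?_⟩, ?_⟩
      · rw [he]; exact hk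
      · refine QuotientAddGroup.eq.2 ((le_sup_right : _ ≤ M ⊔ AddSubgroup.zmultiples u) ?_)
        exact ⟨⌊b⌋ + 1, by simp only [neg_smul]; abel⟩
    · refine Set.image_mono ?_
      rintro g ⟨hg, hgS, -⟩
      refine ⟨hg, ?_⟩
      obtain ⟨θ, -, -, a, ha, z, hz, haz⟩ := mem_add_segment_zero.1 hgS
      refine ⟨a + θ • u, Submodule.add_mem_sup ha (Submodule.smul_mem _ _
        (Submodule.mem_span_singleton_self u)), z, hz, ?_⟩
      rw [← sub_add_cancel (x - g) (θ • u), ← haz]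
      simp only; abel
  have hinj : ((QuotientAddGroup.mk : X → X ⧸ M ⊔ AddSubgroup.zmultiples u) '' D).encard =
      ((QuotientAddGroup.mk : X → X ⧸ M) '' D).encard := by
    let φ : X ⧸ M →+ X ⧸ M ⊔ AddSubgroup.zmultiples u :=
      QuotientAddGroup.map M _ (AddMonoidHom.id X) (by simp)
    have : (QuotientAddGroup.mk : X → X ⧸ M ⊔ AddSubgroup.zmultiples u) '' D =
        φ '' ((QuotientAddGroup.mk : X → X ⧸ M) '' D) := by
      rw [Set.image_image]; rfl
    rw [this]
    refine Set.InjOn.encard_image ?_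
    rintro _ ⟨d, hd, rfl⟩ _ ⟨e, he, rfl⟩ hde
    obtain ⟨a, ha, r, hr, har⟩ := AddSubgroup.mem_sup.1 (QuotientAddGroup.eq.1 hde)
    obtain ⟨k, rfl⟩ := hr
    simp only at har
    obtain ⟨θ, -, -, hθ⟩ := mem_add_segment_zero.1 hd.2.1
    obtain ⟨b, hb⟩ := exists_forall_mem_add_segment_diff_iff hSc hScl (y := x - d) (u := u)
      ⟨-θ, by simpa [neg_smul, ← sub_eq_add_neg] using hθ⟩ (isBounded_setOf_add_smul_mem hK hu _)
    have h0 := (hb 0).1 (by simpa using hd.2)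
    have he' : x - d + ((-k : ℤ) : ℝ) • u = x - e + a := by
      have : e = d + (a + k • u) := by
        simp only [AddMonoidHom.id_apply] at har
        rw [har]; abel
      rw [Int.cast_smul_eq_zsmul, neg_smul, this]; abel
    have haV := hMV a ha
    have h1 := (hb ((-k : ℤ) : ℝ)).1 (by
      rw [he']
      refine ⟨hSV' _ he.2.1 a haV, fun h => he.2.2 ?_⟩
      simpa using hSV _ h (-a) (V.neg_mem haV))
    have hk : k = 0 := by
      have h2 : ((-k : ℤ) : ℝ) < 1 := by linarith
      have h3 : (-1 : ℝ) < ((-k : ℤ) : ℝ) := by linarith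
      have h2' : -k < 1 := by exact_mod_cast h2
      have h3' : -1 < -k := by exact_mod_cast h3
      omega
    subst hk
    refine QuotientAddGroup.eq.2 ?_
    rw [← (by simpa using har : a = -d + e)]
    exact ha
  rw [cosetCount, hsplit, Set.image_union, Set.encard_union_eq hdisj, ← hinj, ← hDC]
  rfl

/-! ### Covering multiplicities of zonotopes -/

lemma isCompact_segment_zero (u : X) : IsCompact (segment ℝ 0 u) := by
  rw [segment_eq_image']
  exact isCompact_Icc.image (by fun_prop)

lemma isCompact_sum_segment {ι : Type*} (s : Finset ι) (u : ι → X) :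
    IsCompact (∑ i ∈ s, segment ℝ 0 (u i)) := by
  classical
  induction s using Finset.induction_on with
  | empty => simp
  | insert i s hi ih => rw [Finset.sum_insert hi]; exact (isCompact_segment_zero _).add ih

lemma convex_sum_segment {ι : Type*} (s : Finset ι) (u : ι → X) :
    Convex ℝ (∑ i ∈ s, segment ℝ 0 (u i)) := by
  classical
  induction s using Finset.induction_on with
  | empty => rw [Finset.sum_empty]; exact convex_singleton 0
  | insert i s hi ih => rw [Finset.sum_insert hi]; exact (convex_segment _ _).add ih

lemma sum_segment_subset {ι : Type*} (s : Finset ι) (u : ι → X) (H : Submodule ℝ X)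
    (hu : ∀ i ∈ s, u i ∈ H) : ∑ i ∈ s, segment ℝ 0 (u i) ⊆ (H : Set X) := by
  classical
  induction s using Finset.induction_on with
  | empty => simp
  | insert i s hi ih =>
    rw [Finset.sum_insert hi]
    rintro _ ⟨a, ha, b, hb, rfl⟩
    exact H.add_mem (H.convex.segment_subset H.zero_mem (hu i (Finset.mem_insert_self i s)) ha)
      (ih (fun j hj => hu j (Finset.mem_insert_of_mem hj)) hb)

lemma cosetCount_add_mem {M : AddSubgroup X} {W K : Set X} {V : Submodule ℝ X} {a : X}
    (ha : a ∈ V) (x : X) :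
    cosetCount M W ((V : Set X) + K) (x + a) = cosetCount M W ((V : Set X) + K) x := by
  have key : ∀ y : X, ∀ b ∈ V, y ∈ (V : Set X) + K → y + b ∈ (V : Set X) + K := by
    rintro _ b hb ⟨c, hc, z, hz, rfl⟩
    exact ⟨c + b, V.add_mem hc hb, z, hz, by simp only; abel⟩
  have : ∀ g : X, x + a - g ∈ (V : Set X) + K ↔ x - g ∈ (V : Set X) + K := fun g => by
    constructor
    · intro h
      convert key _ (-a) (V.neg_mem ha) h using 1
      abel
    · intro h
      convert key _ a ha h using 1
      abel
  simp only [cosetCount, this]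

section Measure

variable [FiniteDimensional ℝ X] [MeasurableSpace X] [BorelSpace X] {μ : Measure X}
  [μ.IsAddHaarMeasure]

lemma ae_comp_sub {Y : Type*} [AddCommGroup Y] [MeasurableSpace Y] [MeasurableAdd Y]
    {μ : Measure Y} [μ.IsAddRightInvariant] {p : Y → Prop} (h : ∀ᵐ x ∂μ, p x) (a : Y) :
    ∀ᵐ x ∂μ, p (x - a) :=
  (measurePreserving_sub_right μ a).quasiMeasurePreserving.ae h

lemma ae_cosetCount_eq_zero {Y : Type*} [AddCommGroup Y] [MeasurableSpace Y] [MeasurableAdd Y]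
    {μ : Measure Y} [μ.IsAddRightInvariant] (M : AddSubgroup Y) {W S : Set Y} (hW : W.Countable)
    (hS : μ S = 0) : ∀ᵐ x ∂μ, cosetCount M W S x = 0 := by
  have : ∀ᵐ x ∂μ, ∀ g ∈ W, x - g ∉ S :=
    (ae_ball_iff hW).2 fun g _ => ae_comp_sub (measure_eq_zero_iff_ae_notMem.1 hS) g
  filter_upwards [this] with x hx
  rw [cosetCount, Set.encard_eq_zero, Set.image_eq_empty, Set.eq_empty_iff_forall_notMem]
  exact fun g hg => hx g hg.1 hg.2

/-- Translating a zonotope by a countable group containing its generators covers almost every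
point equally often. The subspace `V`, by which everything is thickened, makes the induction
on the generators work: at its bottom only `V` is left, and `V` is everything or a null set. -/
lemma exists_ae_cosetCount_eq (G : AddSubgroup X) (hG : (G : Set X).Countable) {ι : Type*}
    (s : Finset ι) (u : ι → X) (hu : ∀ i ∈ s, u i ∈ G) (M : AddSubgroup X) (V : Submodule ℝ X)
    (hMV : ∀ g ∈ M, g ∈ V) :
    ∃ c : ℕ∞, ∀ᵐ x ∂μ, cosetCount M G ((V : Set X) + ∑ i ∈ s, segment ℝ 0 (u i)) x = c := by
  classical
  induction s using Finset.induction_on generalizing M V with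
  | empty =>
    simp only [Finset.sum_empty, add_zero]
    by_cases hV : V = ⊤
    · refine ⟨((QuotientAddGroup.mk : X → X ⧸ M) '' G).encard, ?_⟩
      simp [cosetCount, hV]
    · exact ⟨0, ae_cosetCount_eq_zero M hG (Measure.addHaar_submodule μ V hV)⟩
  | insert i s hi ih =>
    have hs := fun j hj => hu j (Finset.mem_insert_of_mem hj)
    have hiG := hu i (Finset.mem_insert_self i s)
    rw [Finset.sum_insert hi, add_comm (segment ℝ 0 (u i))]
    by_cases hV : u i ∈ V
    · have : (V : Set X) + (∑ i ∈ s, segment ℝ 0 (u i) + segment ℝ 0 (u i)) =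
          (V : Set X) + ∑ i ∈ s, segment ℝ 0 (u i) := by
        rw [add_comm (∑ i ∈ s, segment ℝ 0 (u i)), ← add_assoc]
        congr 1
        apply subset_antisymm
        · rintro _ ⟨a, ha, b, hb, rfl⟩
          exact V.add_mem ha (V.convex.segment_subset V.zero_mem hV hb)
        · exact fun a ha => ⟨a, ha, 0, left_mem_segment _ _ _, add_zero a⟩
      rw [this]
      exact ih hs M V hMV
    · obtain ⟨c, hc⟩ := ih hs M V hMV
      obtain ⟨d, hd⟩ := ih hs (M ⊔ AddSubgroup.zmultiples (u i)) (V ⊔ Submodule.span ℝ {u i}) (by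
        intro g hg
        obtain ⟨a, ha, r, ⟨k, rfl⟩, rfl⟩ := AddSubgroup.mem_sup.1 hg
        exact Submodule.add_mem_sup (hMV a ha)
          (zsmul_mem (Submodule.mem_span_singleton_self (u i)) k))
      refine ⟨c + d, ?_⟩
      filter_upwards [hc, hd] with x h1 h2
      rw [cosetCount_add_segment hMV (isCompact_sum_segment s u) (convex_sum_segment s u) hV
        (fun g hg k => G.add_mem hg (G.zsmul_mem hiG k)), h1, h2]

/-- If shifting by `E` and shifting by `O` have the same effect on all functions that are constant
along one of the directions `v i`, then they have the same effect on the multiplicity of the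
translates by `W` of the sum of the `[v i]` and a null set `B`: by `cosetCount_add_segment` this
multiplicity is almost everywhere a sum of such functions. -/
lemma ae_sum_cosetCount_eq {ι : Type*} (s : Finset ι) (v : ι → X) {B W : Set X}
    (hB : IsCompact B) (hBc : Convex ℝ B) (hB0 : μ B = 0) (hWc : W.Countable)
    (hW : ∀ i ∈ s, ∀ g ∈ W, ∀ k : ℤ, g + k • v i ∈ W) {E O : Finset X}
    (hEO : ∀ i ∈ s, v i ≠ 0 → ∀ f : X → ℕ∞, (∀ x, ∀ t : ℝ, f (x + t • v i) = f x) →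
      ∀ x, ∑ e ∈ E, f (x - e) = ∑ o ∈ O, f (x - o)) :
    ∀ᵐ x ∂μ, ∑ e ∈ E, cosetCount ⊥ W (B + ∑ i ∈ s, segment ℝ 0 (v i)) (x - e) =
      ∑ o ∈ O, cosetCount ⊥ W (B + ∑ i ∈ s, segment ℝ 0 (v i)) (x - o) := by
  classical
  induction s using Finset.induction_on with
  | empty =>
    simp only [Finset.sum_empty, add_zero]
    have h0 := ae_cosetCount_eq_zero (μ := μ) ⊥ hWc hB0
    have h1 : ∀ F : Finset X, ∀ᵐ x ∂μ, ∀ e ∈ F, cosetCount ⊥ W B (x - e) = 0 := fun F =>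
      (ae_ball_iff F.countable_toSet).2 fun e _ => ae_comp_sub h0 e
    filter_upwards [h1 E, h1 O] with x hE hO
    rw [Finset.sum_eq_zero hE, Finset.sum_eq_zero hO]
  | insert i s hi ih =>
    have hi' := Finset.mem_insert_self i s
    have ih := ih (fun j hj => hW j (Finset.mem_insert_of_mem hj))
      (fun j hj => hEO j (Finset.mem_insert_of_mem hj))
    rw [Finset.sum_insert hi, add_comm (segment ℝ 0 (v i)), ← add_assoc]
    set K := B + ∑ i ∈ s, segment ℝ 0 (v i)
    by_cases hv : v i = 0
    · simpa [hv] using ih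
    have hstep := cosetCount_add_segment (M := ⊥) (V := ⊥) (by simp)
      (hB.add (isCompact_sum_segment s v)) (hBc.add (convex_sum_segment s v))
      (u := v i) (by simpa using hv) (hW i hi')
    simp only [Submodule.bot_coe, Set.singleton_zero, zero_add] at hstep
    filter_upwards [ih] with x hx
    simp only [K, hstep, Finset.sum_add_distrib] at hx ⊢
    rw [hx, hEO i hi' hv _ fun y t => cosetCount_add_mem
      (Submodule.mem_sup_right (Submodule.smul_mem _ t (Submodule.mem_span_singleton_self _))) y]

end Measure

/-! ### Finite sets with equal shifts of functions constant along given directions -/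

/-- There are finite sets `E` and `O`, all of whose points are distinct modulo `G`, such that
shifts by `E` and by `O` agree on every function constant along some `v i`. They are the sums of an
even, respectively odd, number of generic multiples `tᵢ vᵢ`; in terms of measures,
`δ_E - δ_O` is the convolution of the `δ_0 - δ_{tᵢ vᵢ}`. -/
lemma exists_finset_sum_comp_sub_eq (G : AddSubgroup X) (hG : (G : Set X).Countable)
    {ι : Type*} (s : Finset ι) (v : ι → X) (hv : ∀ i ∈ s, v i ≠ 0) :
    ∃ E O : Finset X, 0 ∈ E ∧ Disjoint E O ∧
      (∀ a, (a ∈ E ∨ a ∈ O) → ∀ b, (b ∈ E ∨ b ∈ O) → a - b ∈ G → a = b) ∧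
      ∀ i ∈ s, ∀ f : X → ℕ∞, (∀ x, ∀ t : ℝ, f (x + t • v i) = f x) →
        ∀ x, ∑ e ∈ E, f (x - e) = ∑ o ∈ O, f (x - o) := by
  classical
  induction s using Finset.induction_on with
  | empty => exact ⟨{0}, ∅, by simp, by simp, by simp, by simp⟩
  | insert i s hi ih =>
    obtain ⟨E, O, h0, hd, hinc, hsum⟩ := ih fun j hj => hv j (Finset.mem_insert_of_mem hj)
    have hvi := hv i (Finset.mem_insert_self i s)
    let F : Set X := ↑(E ∪ O)
    have hFc : F.Countable := (E ∪ O).countable_toSet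
    -- Only countably many `t` make some shifted point congruent to an unshifted one.
    let Z : Set X := F - F + G
    have hZ : Z.Countable := (hFc.image2 hFc _).image2 hG _
    have hinj : Function.Injective fun t : ℝ => t • v i := smul_left_injective ℝ hvi
    obtain ⟨t, ht⟩ := ((hZ.preimage_of_injOn (f := fun t : ℝ => t • v i)
      hinj.injOn).dense_compl ℝ).nonempty
    have ht : ∀ a, (a ∈ E ∨ a ∈ O) → ∀ b, (b ∈ E ∨ b ∈ O) → a + t • v i - b ∉ G := by
      intro a ha b hb h
      refine ht ⟨b - a, ⟨b, ?_, a, ?_, rfl⟩, _, h, ?_⟩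
      · simpa [F] using hb
      · simpa [F] using ha
      · simp only; abel
    have ht' : ∀ a, (a ∈ E ∨ a ∈ O) → ∀ b, (b ∈ E ∨ b ∈ O) → a - (b + t • v i) ∉ G := by
      intro a ha b hb h
      refine ht b hb a ha ?_
      simpa using G.neg_mem h
    have hmemE : ∀ a, a ∈ E ∪ O.image (· + t • v i) ↔ a ∈ E ∨ ∃ o ∈ O, o + t • v i = a := fun a => by
      rw [Finset.mem_union, Finset.mem_image]
    have hmemO : ∀ a, a ∈ O ∪ E.image (· + t • v i) ↔ a ∈ O ∨ ∃ o ∈ E, o + t • v i = a := fun a => by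
      rw [Finset.mem_union, Finset.mem_image]
    have hne : ∀ a, (a ∈ E ∨ a ∈ O) → ∀ b, (b ∈ E ∨ b ∈ O) → a + t • v i ≠ b := fun a ha b hb h =>
      ht a ha b hb (by rw [h, sub_self]; exact G.zero_mem)
    have hdE : Disjoint E (O.image (· + t • v i)) := by
      rw [Finset.disjoint_left]
      rintro a ha ha'
      obtain ⟨b, hb, hba⟩ := Finset.mem_image.1 ha'
      exact hne b (.inr hb) a (.inl ha) hba
    have hdO : Disjoint O (E.image (· + t • v i)) := by
      rw [Finset.disjoint_left]
      rintro a ha ha'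
      obtain ⟨b, hb, hba⟩ := Finset.mem_image.1 ha'
      exact hne b (.inl hb) a (.inr ha) hba
    refine ⟨E ∪ O.image (· + t • v i), O ∪ E.image (· + t • v i), by simp [h0], ?_, ?_, ?_⟩
    · rw [Finset.disjoint_left]
      intro a ha hb
      rcases (hmemE a).1 ha with ha | ⟨p, hp, rfl⟩ <;>
        rcases (hmemO _).1 hb with hb | ⟨q, hq, hqa⟩
      · exact Finset.disjoint_left.1 hd ha hb
      · exact hne q (.inl hq) a (.inl ha) hqa
      · exact hne p (.inr hp) _ (.inr hb) rfl
      · exact Finset.disjoint_left.1 hd hq (add_right_cancel hqa ▸ hp)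
    · have key : ∀ a, (a ∈ E ∪ O.image (· + t • v i) ∨ a ∈ O ∪ E.image (· + t • v i)) →
          (a ∈ E ∨ a ∈ O) ∨ ∃ p, (p ∈ E ∨ p ∈ O) ∧ p + t • v i = a := by
        intro a ha
        rw [hmemE, hmemO] at ha
        rcases ha with (ha | ⟨p, hp, h⟩) | (ha | ⟨p, hp, h⟩)
        exacts [.inl (.inl ha), .inr ⟨p, .inr hp, h⟩, .inl (.inr ha), .inr ⟨p, .inl hp, h⟩]
      intro a ha b hb hab
      rcases key a ha with ha | ⟨p, hp, rfl⟩ <;> rcases key b hb with hb | ⟨q, hq, rfl⟩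
      · exact hinc a ha b hb hab
      · exact absurd hab (ht' a ha q hq)
      · exact absurd hab (ht p hp b hb)
      · rw [hinc p hp q hq (by simpa using hab)]
    · intro j hj f hf x
      have hinj' : Function.Injective (· + t • v i) := add_left_injective _
      rw [Finset.sum_union hdE, Finset.sum_union hdO, Finset.sum_image hinj'.injOn,
        Finset.sum_image hinj'.injOn]
      simp only [sub_add_eq_sub_sub_swap]
      rcases Finset.mem_insert.1 hj with rfl | hj
      · have : ∀ y z, f (y - t • v j - z) = f (y - z) := fun y z => by
          rw [← hf _ t]; congr 1; abel
        simp only [this]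
        exact add_comm _ _
      · rw [hsum j hj f hf x, hsum j hj f hf (x - t • v i)]

/-! ### Counting the translates in a tiling -/

/-- The translates of `W` by a finite set `F` of pairwise incongruent vectors are disjoint, so the
covering multiplicity of their union is the sum of the shifted multiplicities. -/
lemma encard_setOf_shifted {Y : Type*} [AddCommGroup Y] {G : AddSubgroup Y} {W : Set Y}
    (hW : W ⊆ G) (F : Finset Y) (hF : ∀ a ∈ F, ∀ b ∈ F, a - b ∈ G → a = b) (S : Set Y) (x : Y) :
    {l | (∃ a ∈ F, ∃ g ∈ W, g + a = l) ∧ x - l ∈ S}.encard =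
      ∑ a ∈ F, cosetCount ⊥ W S (x - a) := by
  have h : {l | (∃ a ∈ F, ∃ g ∈ W, g + a = l) ∧ x - l ∈ S} =
      ⋃ a ∈ (F : Set Y), (· + a) '' {g | g ∈ W ∧ x - a - g ∈ S} := by
    ext l
    simp only [Set.mem_ofPred_eq, Set.mem_iUnion, Set.mem_image, Finset.mem_coe, exists_prop]
    constructor
    · rintro ⟨⟨a, ha, g, hg, rfl⟩, hl⟩
      exact ⟨a, ha, g, ⟨hg, by rwa [sub_add_eq_sub_sub_swap] at hl⟩, rfl⟩
    · rintro ⟨a, ha, g, ⟨hg, hl⟩, rfl⟩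
      exact ⟨⟨a, ha, g, hg, rfl⟩, by rwa [sub_add_eq_sub_sub_swap]⟩
  rw [h, F.finite_toSet.encard_biUnion, finsum_mem_coe_finset]
  · refine Finset.sum_congr rfl fun a _ => ?_
    rw [cosetCount_bot, (add_left_injective a).encard_image]
  · intro a ha b hb hab
    rw [Function.onFun, Set.disjoint_left]
    rintro _ ⟨g, ⟨hg, -⟩, rfl⟩ ⟨g', ⟨hg', -⟩, hgg⟩
    refine hab (hF a ha b hb ?_)
    have : a - b = g' - g := by
      rw [sub_eq_sub_iff_add_eq_add, add_comm a]
      exact hgg.symm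
    rw [this]
    exact G.sub_mem (hW hg') (hW hg)

lemma tsum_indicator_vadd {Y : Type*} [AddCommGroup Y] (Λ P : Set Y) (x : Y) :
    ∑' l : Λ, ((l : Y) +ᵥ P).indicator (fun _ => (1 : ℝ≥0∞)) x =
      ({l | l ∈ Λ ∧ x - l ∈ P}.encard : ℝ≥0∞) := by
  classical
  rw [← ENNReal.tsum_set_one, tsum_subtype Λ fun l => (l +ᵥ P).indicator (fun _ => (1 : ℝ≥0∞)) x,
    tsum_subtype _ fun _ => (1 : ℝ≥0∞)]
  refine tsum_congr fun l => ?_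
  simp only [Set.indicator_apply, Set.mem_vadd_set_iff_neg_vadd_mem, vadd_eq_add,
    Set.mem_ofPred_eq, neg_add_eq_sub]
  split_ifs <;> simp_all

/-! ### Locally finite sets and their point masses -/

lemma IsLocallyFinite.mono {A B : Set (EuclideanSpace ℝ (Fin 3))} (hB : IsLocallyFinite B)
    (h : A ⊆ B) : IsLocallyFinite A :=
  fun R => (hB R).subset (Set.inter_subset_inter_left _ h)

lemma IsLocallyFinite.biUnion {ι : Type*} {s : Set ι} (hs : s.Finite)
    {A : ι → Set (EuclideanSpace ℝ (Fin 3))} (hA : ∀ i ∈ s, IsLocallyFinite (A i)) :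
    IsLocallyFinite (⋃ i ∈ s, A i) := fun R => by
  rw [Set.iUnion₂_inter]
  exact hs.biUnion fun i hi => hA i hi R

lemma IsLocallyFinite.finite_inter {A B : Set (EuclideanSpace ℝ (Fin 3))} (hA : IsLocallyFinite A)
    (hB : Bornology.IsBounded B) : (A ∩ B).Finite := by
  obtain ⟨R, hR⟩ := hB.subset_closedBall 0
  exact (hA R).subset (Set.inter_subset_inter_right _ hR)

lemma IsLocallyFinite.countable {A : Set (EuclideanSpace ℝ (Fin 3))} (hA : IsLocallyFinite A) :
    A.Countable := by
  have : A = ⋃ n : ℕ, A ∩ Metric.closedBall 0 n := by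
    rw [← Set.inter_iUnion, Metric.iUnion_closedBall_nat, Set.inter_univ]
  rw [this]
  exact Set.countable_iUnion fun n => (hA n).countable

lemma isLocallyFinite_addSubgroup (G : AddSubgroup (EuclideanSpace ℝ (Fin 3)))
    [DiscreteTopology G] : IsLocallyFinite G := fun R => by
  rw [Set.inter_comm]
  exact Metric.finite_isBounded_inter_isClosed DiscreteTopology.isDiscrete
    Metric.isBounded_closedBall AddSubgroup.isClosed_of_discrete

lemma IsLocallyFinite.vadd {A : Set (EuclideanSpace ℝ (Fin 3))} (hA : IsLocallyFinite A)
    (a : EuclideanSpace ℝ (Fin 3)) : IsLocallyFinite (a +ᵥ A) := fun R => by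
  have := (hA.finite_inter (Metric.isBounded_closedBall (x := (0 : EuclideanSpace ℝ (Fin 3)))
    (r := R + ‖a‖))).image (a +ᵥ ·)
  refine this.subset ?_
  rintro _ ⟨⟨b, hb, rfl⟩, hR⟩
  refine ⟨b, ⟨hb, ?_⟩, rfl⟩
  simp only [vadd_eq_add, mem_closedBall_zero_iff] at hR ⊢
  have := norm_sub_le (a + b) a
  rw [add_sub_cancel_left] at this
  linarith

lemma IsTranslatedLattice.isLocallyFinite {A : Set (EuclideanSpace ℝ (Fin 3))}
    (hA : IsTranslatedLattice A) : IsLocallyFinite A := by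
  obtain ⟨t, L, _, rfl⟩ := hA
  exact (isLocallyFinite_addSubgroup L).vadd t

lemma IsLocallyFinite.exists_le_dist {A : Set (EuclideanSpace ℝ (Fin 3))}
    (hA : IsLocallyFinite A) (p : EuclideanSpace ℝ (Fin 3)) :
    ∃ r > 0, ∀ a ∈ A, a ≠ p → r ≤ dist a p := by
  have hfin : ((A ∩ Metric.closedBall p 1) \ {p}).Finite :=
    (hA.finite_inter Metric.isBounded_closedBall).sdiff
  obtain ⟨r, hr, hrp⟩ := Metric.isOpen_iff.1 hfin.isClosed.isOpen_compl p (by simp)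
  refine ⟨min r 1, lt_min hr one_pos, fun a ha hap => ?_⟩
  by_contra! hlt
  exact hrp (Metric.mem_ball.2 (hlt.trans_le (min_le_left _ _)))
    ⟨⟨ha, Metric.mem_closedBall.2 (hlt.le.trans (min_le_right _ _))⟩, hap⟩

open Classical in
lemma integral_delta_eq_ite {A : Set (EuclideanSpace ℝ (Fin 3))} (hA : A.Countable)
    {φ : EuclideanSpace ℝ (Fin 3) → ℂ} {p : EuclideanSpace ℝ (Fin 3)} (hp : φ p = 1)
    (h0 : ∀ a ∈ A, a ≠ p → φ a = 0) :
    ∫ x, φ x ∂(delta A) = if p ∈ A then 1 else 0 := by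
  have : Countable A := hA
  have hae : φ =ᵐ[delta A] ({p} : Set _).indicator fun _ => (1 : ℂ) := by
    refine Measure.ae_sum_iff.2 fun a => ?_
    rw [ae_dirac_eq]
    by_cases h : (a : EuclideanSpace ℝ (Fin 3)) = p
    · simp [h, hp]
    · simp [h, h0 a a.2 h]
  rw [integral_congr_ae hae, integral_indicator (measurableSet_singleton p), setIntegral_const]
  have hm : delta A {p} = if p ∈ A then 1 else 0 := by
    rw [delta, Measure.sum_apply _ (measurableSet_singleton p)]
    simp only [Measure.dirac_apply]
    split_ifs with h
    · rw [tsum_eq_single ⟨p, h⟩ fun b hb => ?_]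
      · simp
      · rw [Set.indicator_of_notMem]
        exact fun hbp => hb (Subtype.ext (Set.mem_singleton_iff.1 hbp))
    · refine ENNReal.tsum_eq_zero.2 fun b => Set.indicator_of_notMem (fun hbp => h ?_) _
      rw [← Set.mem_singleton_iff.1 hbp]
      exact b.2
  rw [measureReal_def, hm]
  split_ifs <;> simp

/-! ### Translated lattices on a line -/

/-- On the line `ℤ u`, a translated lattice is empty, a single point, or periodic. In each case it
does not distinguish `m u` from `-m u` when `m > 0` is a multiple of a suitable number. -/
lemma IsTranslatedLattice.exists_zsmul_mem_iff {A : Set (EuclideanSpace ℝ (Fin 3))}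
    (hA : IsTranslatedLattice A) (u : EuclideanSpace ℝ (Fin 3)) :
    ∃ p : ℤ, 0 < p ∧ ∀ m : ℤ, 0 < m → p ∣ m → (m • u ∈ A ↔ -m • u ∈ A) := by
  obtain ⟨t, L, -, rfl⟩ := hA
  have hmem : ∀ j : ℤ, j • u ∈ t +ᵥ (L : Set (EuclideanSpace ℝ (Fin 3))) ↔ -t + j • u ∈ L :=
    fun j => by
      rw [Set.mem_vadd_set_iff_neg_vadd_mem, vadd_eq_add]; rfl
  simp only [hmem]
  by_cases h : ∃ d : ℤ, 0 < d ∧ d • u ∈ L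
  · obtain ⟨d, hd, hdu⟩ := h
    refine ⟨d, hd, ?_⟩
    rintro m - ⟨k, rfl⟩
    have : -t + (d * k) • u = (-t + -(d * k) • u) + (2 * k) • d • u := by
      rw [smul_smul, add_assoc, ← add_smul]; congr 2; ring
    rw [this]
    exact L.add_mem_cancel_right (L.zsmul_mem hdu _)
  · have huniq : ∀ i j : ℤ, -t + i • u ∈ L → -t + j • u ∈ L → i = j := by
      have key : ∀ i j : ℤ, -t + i • u ∈ L → -t + j • u ∈ L → i ≤ j := by
        intro i j hi hj
        by_contra! hlt
        refine h ⟨i - j, by omega, ?_⟩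
        convert L.sub_mem hi hj using 1
        rw [sub_smul]; abel
      exact fun i j hi hj => le_antisymm (key i j hi hj) (key j i hj hi)
    by_cases hj : ∃ j : ℤ, -t + j • u ∈ L
    · obtain ⟨j, hj⟩ := hj
      -- Multiples of `|j| + 1` with `m > 0` exceed `|j|`, so neither `m` nor `-m` equals `j`.
      refine ⟨|j| + 1, by positivity, fun m hm hdvd => ?_⟩
      have hle := Int.le_of_dvd hm hdvd
      have h1 : -t + m • u ∉ L := fun hmL => by
        have := huniq _ _ hmL hj
        have := le_abs_self j
        omega
      have h2 : -t + -m • u ∉ L := fun hmL => by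
        have := huniq _ _ hmL hj
        have := neg_abs_le j
        omega
      exact iff_of_false h1 h2
    · exact ⟨1, one_pos, fun m _ _ => iff_of_false (fun h => hj ⟨_, h⟩) (fun h => hj ⟨_, h⟩)⟩

/-- A locally finite set that meets the line `ℤ u` exactly in the half-line `ℕ u` is not a
combination of translated lattices. -/
lemma not_isLatticeCombination_delta {Λ : Set (EuclideanSpace ℝ (Fin 3))}
    (hΛ : IsLocallyFinite Λ) (u : EuclideanSpace ℝ (Fin 3))
    (hu : ∀ j : ℤ, j • u ∈ Λ ↔ 0 ≤ j) : ¬ IsLatticeCombination (delta Λ) := by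
  classical
  rintro ⟨N, q, A, hA, hφ⟩
  -- Testing against a bump function supported near `p` compares the point masses at `p`.
  have hmass : ∀ p, (if p ∈ Λ then (1 : ℂ) else 0) = ∑ i, q i * if p ∈ A i then 1 else 0 := by
    intro p
    have hlf : IsLocallyFinite (⋃ i ∈ (Set.univ : Set (Option (Fin N))), i.elim Λ A) := by
      refine IsLocallyFinite.biUnion Set.finite_univ ?_
      rintro (_ | i) -
      exacts [hΛ, (hA i).isLocallyFinite]
    obtain ⟨r, hr, hdist⟩ := hlf.exists_le_dist p
    let b : ContDiffBump p := ⟨r / 2, r, by positivity, by linarith⟩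
    have hb : ∀ a, r ≤ dist a p → ((b a : ℝ) : ℂ) = 0 := fun a ha => by
      rw [b.zero_of_le_dist ha, Complex.ofReal_zero]
    have hbp : ((b p : ℝ) : ℂ) = 1 := by
      rw [b.one_of_mem_closedBall (Metric.mem_closedBall_self b.rIn_pos.le), Complex.ofReal_one]
    have hAi : ∀ (i : Option (Fin N)), ∀ a ∈ (i.elim Λ A : Set _), a ≠ p →
        ((b a : ℝ) : ℂ) = 0 := fun i a ha hap =>
      hb a (hdist a (Set.mem_biUnion (Set.mem_univ i) ha) hap)
    have := hφ (fun x => (b x : ℂ)) (Complex.ofRealCLM.contDiff.comp b.contDiff)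
      (b.hasCompactSupport.comp_left (g := Complex.ofReal) Complex.ofReal_zero)
    rw [integral_delta_eq_ite hΛ.countable hbp (hAi none)] at this
    rw [this]
    exact Finset.sum_congr rfl fun i _ => by
      rw [integral_delta_eq_ite (hA i).isLocallyFinite.countable hbp (hAi (some i))]
  choose p hp0 hp using fun i => (hA i).exists_zsmul_mem_iff u
  set m : ℤ := ∏ i, p i
  have hm : 0 < m := Finset.prod_pos fun i _ => hp0 i
  have h1 := hmass (m • u)
  have h2 := hmass (-m • u)
  rw [if_pos ((hu m).2 hm.le)] at h1
  rw [if_neg (fun h => by have := (hu _).1 h; omega)] at h2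
  refine one_ne_zero (α := ℂ) (h1.trans (Eq.trans ?_ h2.symm))
  exact Finset.sum_congr rfl fun i _ => by
    rw [if_congr (hp i m hm (Finset.dvd_prod_of_mem p (Finset.mem_univ i))) rfl rfl]

end MultipleTiling

/-! ### Tilings by two-flat zonotopes -/

theorem mainTheorem8 {n m : ℕ}
    (v : Fin n → EuclideanSpace ℝ (Fin 3)) (w : Fin m → EuclideanSpace ℝ (Fin 3))
    (H₁ H₂ : Submodule ℝ (EuclideanSpace ℝ (Fin 3)))
    (hH₁ : Module.finrank ℝ H₁ = 2) (hH₂ : Module.finrank ℝ H₂ = 2) (hne : H₁ ≠ H₂)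
    (hv : ∀ i, v i ∈ H₁) (hw : ∀ j, w j ∈ H₂)
    (hspan : Submodule.span ℝ (Set.range v) = H₁)
    (hdisc : DiscreteTopology (AddSubgroup.closure (Set.range v ∪ Set.range w)))
    (P : Set (EuclideanSpace ℝ (Fin 3)))
    (hP : P = MultipleTiling.zonotope (Sum.elim v w))
    (hint : (interior P).Nonempty) :
    ∃ (Λ : Set (EuclideanSpace ℝ (Fin 3))) (k : ℕ),
      0 < k ∧ MultipleTiling.IsLocallyFinite Λ ∧ MultipleTiling.IsKTiling P Λ k ∧
        ¬ MultipleTiling.IsLatticeCombination (MultipleTiling.delta Λ) := by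
  classical
  open MultipleTiling in
  set G := AddSubgroup.closure (Set.range v ∪ Set.range w) with hG
  have hGlf : IsLocallyFinite G := isLocallyFinite_addSubgroup G
  have hGc : (G : Set (EuclideanSpace ℝ (Fin 3))).Countable := hGlf.countable
  have hvG : ∀ i, v i ∈ G := fun i => AddSubgroup.subset_closure (.inl ⟨i, rfl⟩)
  have hwG : ∀ j, w j ∈ G := fun j => AddSubgroup.subset_closure (.inr ⟨j, rfl⟩)
  have htop : ∀ H : Submodule ℝ (EuclideanSpace ℝ (Fin 3)), Module.finrank ℝ H = 2 → H ≠ ⊤ := by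
    rintro H hH rfl
    simp at hH
  obtain ⟨f, hf0, hf⟩ := Submodule.exists_le_ker_of_lt_top H₁ (htop H₁ hH₁).lt_top
  have hfv : ∀ i, f (v i) = 0 := fun i => hf (hv i)
  -- As `P` has interior points, it is not contained in a translate of `H₁`.
  obtain ⟨u, huG, hu⟩ : ∃ u ∈ G, 0 < f u := by
    by_contra! h
    have hfG : ∀ u ∈ G, f u = 0 := fun u hu => le_antisymm (h u hu) (by
      simpa using h _ (G.neg_mem hu))
    have hsub : P ⊆ (LinearMap.ker f : Set (EuclideanSpace ℝ (Fin 3))) := by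
      rw [hP]
      refine sum_segment_subset Finset.univ _ (LinearMap.ker f) ?_
      rintro (i | j) -
      exacts [hfG _ (hvG i), hfG _ (hwG j)]
    have := Submodule.eq_top_of_nonempty_interior' _ (hint.mono (interior_mono hsub))
    exact hf0 (LinearMap.ker_eq_top.1 this)
  obtain ⟨E, O, hE0, hEO, hinc, hsum⟩ :=
    exists_finset_sum_comp_sub_eq G hGc (Finset.univ.filter fun i => v i ≠ 0) v (by simp)
  have hOne : O.Nonempty := by
    obtain ⟨i, hi⟩ : ∃ i, v i ≠ 0 := by
      by_contra! h
      have : Submodule.span ℝ (Set.range v) = ⊥ := by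
        rw [Submodule.span_eq_bot]
        rintro _ ⟨i, rfl⟩
        exact h i
      rw [← hspan, this] at hH₁
      simp at hH₁
    by_contra! hO
    -- Applied to the constant function `1`, the exchange property says `|E| = |O|`.
    have := hsum i (by simpa using hi) (fun _ => 1) (fun _ _ => rfl) 0
    simp [hO] at this
    simp [this] at hE0
  set B := ∑ j, segment ℝ 0 (w j) with hB
  have hB0 : volume B = 0 := measure_mono_null
    (sum_segment_subset Finset.univ w H₂ fun j _ => hw j)
    (Measure.addHaar_submodule volume H₂ (htop H₂ hH₂))
  have hPB : P = B + ∑ i, segment ℝ 0 (v i) := by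
    rw [hP, zonotope, Fintype.sum_sum_type, add_comm]
    rfl
  have hPc : IsCompact P := by
    rw [hP]; exact isCompact_sum_segment _ _
  let Wp : Set (EuclideanSpace ℝ (Fin 3)) := {g | g ∈ G ∧ 0 ≤ f g}
  let Wn : Set (EuclideanSpace ℝ (Fin 3)) := {g | g ∈ G ∧ f g < 0}
  have hWp : Wp ⊆ G := fun g hg => hg.1
  have hWn : Wn ⊆ G := fun g hg => hg.1
  have hexch := ae_sum_cosetCount_eq (μ := volume) Finset.univ v (W := Wp) (E := E) (O := O)
    (isCompact_sum_segment Finset.univ w) (convex_sum_segment Finset.univ w) hB0 (hGc.mono hWp)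
    (fun i _ g hg k => ⟨G.add_mem hg.1 (G.zsmul_mem (hvG i) k), by simpa [hfv] using hg.2⟩)
    (fun i _ hi => hsum i (by simpa using hi))
  rw [← hB, ← hPB] at hexch
  obtain ⟨c, hc⟩ := exists_ae_cosetCount_eq (μ := volume) G hGc Finset.univ (Sum.elim v w)
    (by rintro (i | j) - <;> simp [hvG, hwG]) ⊥ ⊥ (by simp)
  rw [Submodule.bot_coe, Set.singleton_zero, zero_add, ← zonotope, ← hP] at hc
  obtain ⟨x₀, hx₀P, hx₀⟩ :=
    (Measure.dense_of_ae hc).inter_open_nonempty _ isOpen_interior hint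
  have hx₀c : {g | g ∈ G ∧ x₀ - g ∈ P}.encard = c := 
    (cosetCount_bot _ _ _).symm.trans hx₀
  have hcpos : c ≠ 0 := by
    rw [← hx₀c, Set.encard_ne_zero]
    exact ⟨0, G.zero_mem, by simpa using interior_subset hx₀P⟩
  have hcfin : c ≠ ⊤ := by
    rw [← hx₀c, Set.encard_ne_top_iff]
    refine (hGlf.finite_inter (hPc.image (f := fun y => x₀ - y) (by fun_prop)).isBounded).subset ?_
    exact fun g hg => ⟨hg.1, x₀ - g, hg.2, by simp⟩
  lift c to ℕ using hcfin
  let Λp : Set (EuclideanSpace ℝ (Fin 3)) := {l | ∃ a ∈ E, ∃ g ∈ Wp, g + a = l}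
  let Λn : Set (EuclideanSpace ℝ (Fin 3)) := {l | ∃ a ∈ O, ∃ g ∈ Wn, g + a = l}
  have hΛ : IsLocallyFinite (Λp ∪ Λn) := by
    refine (IsLocallyFinite.biUnion (E ∪ O).finite_toSet fun a _ => hGlf.vadd a).mono ?_
    rintro _ (⟨a, ha, g, hg, rfl⟩ | ⟨a, ha, g, hg, rfl⟩)
    · exact Set.mem_biUnion (x := a) (by simp [ha]) ⟨g, hg.1, add_comm _ _⟩
    · exact Set.mem_biUnion (x := a) (by simp [ha]) ⟨g, hg.1, add_comm _ _⟩
  refine ⟨Λp ∪ Λn, O.card * c, Nat.mul_pos hOne.card_pos (Nat.pos_of_ne_zero (by simpa using hcpos)),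
    hΛ, ?_, not_isLatticeCombination_delta hΛ u fun j => ⟨?_, fun hj => ?_⟩⟩
  · have hcO : ∀ᵐ x, ∀ o ∈ O, cosetCount ⊥ G P (x - o) = c :=
      (ae_ball_iff O.countable_toSet).2 fun o _ => ae_comp_sub hc o
    filter_upwards [hexch, hcO] with x hx hxO
    have hsplit : {l | l ∈ Λp ∪ Λn ∧ x - l ∈ P} =
        {l | l ∈ Λp ∧ x - l ∈ P} ∪ {l | l ∈ Λn ∧ x - l ∈ P} := by
      ext l; simp only [Set.mem_ofPred_eq, Set.mem_union, or_and_right]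
    have hdisj : Disjoint {l | l ∈ Λp ∧ x - l ∈ P} {l | l ∈ Λn ∧ x - l ∈ P} := by
      rw [Set.disjoint_left]
      rintro _ ⟨⟨a, ha, g, hg, rfl⟩, -⟩ ⟨⟨b, hb, g', hg', h⟩, -⟩
      have hab : a = b := by
        refine hinc a (.inl ha) b (.inr hb) ?_
        have : a - b = g' - g := by rw [sub_eq_sub_iff_add_eq_add, add_comm a, ← h, add_comm]
        rw [this]
        exact G.sub_mem hg'.1 hg.1
      exact Finset.disjoint_left.1 hEO ha (hab ▸ hb)
    have hGW : ∀ y, cosetCount ⊥ G P y = cosetCount ⊥ Wp P y + cosetCount ⊥ Wn P y := by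
      intro y
      simp only [cosetCount_bot]
      rw [← Set.encard_union_eq]
      · congr 1
        ext g
        simp only [Wp, Wn, Set.mem_ofPred_eq, Set.mem_union, SetLike.mem_coe]
        have := le_or_gt 0 (f g)
        tauto
      · rw [Set.disjoint_left]
        exact fun g hg hg' => absurd hg.1.2 (not_le.2 hg'.1.2)
    have hcp : {l | l ∈ Λp ∧ x - l ∈ P}.encard = ∑ e ∈ E, cosetCount ⊥ Wp P (x - e) :=
      encard_setOf_shifted hWp E (fun a ha b hb => hinc a (.inl ha) b (.inl hb)) P x
    have hcn : {l | l ∈ Λn ∧ x - l ∈ P}.encard = ∑ o ∈ O, cosetCount ⊥ Wn P (x - o) :=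
      encard_setOf_shifted hWn O (fun a ha b hb => hinc a (.inr ha) b (.inr hb)) P x
    rw [tsum_indicator_vadd, hsplit, Set.encard_union_eq hdisj, hcp, hcn, hx,
      ← Finset.sum_add_distrib, Finset.sum_congr rfl fun o ho => (hGW (x - o)).symm.trans (hxO o ho)]
    simp
  -- A point `j u` lies in `G`, so its representation in `Λ` uses the shift `0`, which is in `E`.
  · rintro (⟨a, ha, g, hg, h⟩ | ⟨a, ha, g, hg, h⟩)
    all_goals
      have ha0 : a = 0 := by
        refine hinc a (by tauto) 0 (.inl hE0) ?_
        rw [sub_zero, eq_sub_of_add_eq' h]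
        exact G.sub_mem (G.zsmul_mem huG j) hg.1
    · rw [ha0, add_zero] at h
      have hfj := hg.2
      rw [h, map_zsmul, zsmul_eq_mul] at hfj
      exact_mod_cast nonneg_of_mul_nonneg_left hfj hu
    · exact absurd (ha0 ▸ ha) (Finset.disjoint_left.1 hEO hE0)
  · refine .inl ⟨0, hE0, j • u, ⟨G.zsmul_mem huG j, ?_⟩, add_zero _⟩
    rw [map_zsmul]
    exact zsmul_nonneg hu.le hj
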